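/- Let $(\Omega,\mathcal F,\Pr)$ be a probability space with an invertible, bi-measurable, measure-preserving ergodic map $\theta:\Omega\to\Omega$, let $\mathcal A$ be a finite set, and let $\mathcal V=(V_{a;\omega})_{a\in\mathcal A}$ be a disordered perfect Kraus measurement ensemble on $\mathcal A$, that is, $\omega\mapsto V_{a;\omega}\in M_d(\mathbb C)$ is measurable for every $a$ and $\sum_{a\in\mathcal A}V_{a;\omega}^\dagger V_{a;\omega}=1$ for every $\omega$. For $\bar a=(a_1,\dots,a_n)\in\mathcal A^n$ put $V^{(n)}_{\bar a;\omega}=V_{a_n;\theta^n(\omega)}\cdots V_{a_1;\theta(\omega)}$. For a state (density matrix) $\varrho\in M_d(\mathbb C)$ let $\mathbb Q_{\varrho;\omega}$ be the probability measure on $\mathcal A^{\mathbb N}$ under which the first $n$ outcomes are $\bar a\in\mathcal A^n$ with probability $\operatorname{tr}(V^{(n)}_{\bar a;\omega}\varrho V^{(n)\dagger}_{\bar a;\omega})$, and let $\rho^{(n)}_{\varrho;\omega}=V^{(n)}_{\bar a;\omega}\varrho V^{(n)\dagger}_{\bar a;\omega}/\operatorname{tr}(V^{(n)}_{\bar a;\omega}\varrho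 V^{(n)\dagger}_{\bar a;\omega})$ be the quantum trajectory. The ensemble $\mathcal V$ *asymptotically purifies* if for $\Pr$-almost every $\omega$, for every state $\varrho$ and every integer $m\ge1$, $\operatorname{tr}\big((\rho^{(n)}_{\varrho;\omega})^m\big)\to1$ as $n\to\infty$, $\mathbb Q_{\varrho;\omega}$-almost surely. An orthogonal projection $p\in M_d(\mathbb C)$ of rank at least $2$ is *dark* for $\omega$, and its range is a *dark subspace*, if for all $n\ge1$ and all $\bar a\in\mathcal A^n$ there is $\lambda\in[0,1]$ with $pV^{(n)\dagger}_{\bar a;\omega}V^{(n)}_{\bar a;\omega}p=\lambda p$. Let $\mathscr D_\omega$ be the set of dark projections for $\omega$. Then $\{\omega:\mathscr D_\omega=\emptyset\}$ is an event (a measurable set), and $\mathcal V$ asymptotically purifies if and only if $\Pr(\mathscr D=\emptyset)>0$, that is, if and only if with positive probability there is no dark subspace of rank at least $2$. -/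

import Mathlib

open MeasureTheory ProbabilityTheory Filter Topology
open scoped Matrix ENNReal ComplexOrder

noncomputable section

namespace QTraj

/-- The set of states (density matrices) of `M_d(ℂ)`. -/
structure State (d : ℕ) where
  mat : Matrix (Fin d) (Fin d) ℂ
  posSemidef : mat.PosSemidef
  trace_eq_one : mat.trace = 1

/-- A perfect Kraus measurement on the finite outcome set `A`: one Kraus operator `V a` for every
outcome `a`, with `∑ a, (V a)† (V a) = 1`. -/
structure KrausMeasurement (d : ℕ) (A : Type*) [Fintype A] where
  op : A → Matrix (Fin d) (Fin d) ℂ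
  sum_eq_one : ∑ a, (op a)ᴴ * op a = 1

/-- A disordered perfect Kraus measurement: a random variable on the disorder space `Ω` with values
in the perfect Kraus measurements on `A`. -/
structure DisorderedMeasurement (Ω : Type*) [MeasurableSpace Ω] (d : ℕ) (A : Type*) [Fintype A] where
  meas : Ω → KrausMeasurement d A
  measurable_entry : ∀ a i j, Measurable fun ω => (meas ω).op a i j

variable {d : ℕ}

/-- `tr (V ρ V†)`, a real number, the probability of the outcome with Kraus operator `V`. -/
def outcomeProb (V : Matrix (Fin d) (Fin d) ℂ) (ρ : State d) : ℝ :=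
  (V * ρ.mat * Vᴴ).trace.re

theorem posSemidef_conj (V : Matrix (Fin d) (Fin d) ℂ) (ρ : State d) :
    (V * ρ.mat * Vᴴ).PosSemidef :=
  ρ.posSemidef.mul_mul_conjTranspose_same V

theorem outcomeProb_nonneg (V : Matrix (Fin d) (Fin d) ℂ) (ρ : State d) :
    0 ≤ outcomeProb V ρ :=
  (Complex.le_def.1 (posSemidef_conj V ρ).trace_nonneg).1

theorem trace_conj_eq (V : Matrix (Fin d) (Fin d) ℂ) (ρ : State d) :
    (V * ρ.mat * Vᴴ).trace = (outcomeProb V ρ : ℂ) := by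
  have h := Complex.le_def.1 (posSemidef_conj V ρ).trace_nonneg
  exact Complex.ext rfl (by simpa using h.2.symm)

open Classical in
/-- The state update `V · ρ = V ρ V† / tr (V ρ V†)`. When `tr (V ρ V†) = 0`, which is an event of
probability zero, the value is by convention `ρ`. -/
def update (V : Matrix (Fin d) (Fin d) ℂ) (ρ : State d) : State d :=
  if h : outcomeProb V ρ = 0 then ρ
  else ⟨((outcomeProb V ρ : ℝ) : ℂ)⁻¹ • (V * ρ.mat * Vᴴ), by
      rw [← Complex.ofReal_inv]
      exact (posSemidef_conj V ρ).smul
        (Complex.zero_le_real.2 (inv_nonneg.2 (outcomeProb_nonneg V ρ))), by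
      rw [Matrix.trace_smul, trace_conj_eq, smul_eq_mul]
      exact inv_mul_cancel₀ (by exact_mod_cast h)⟩

/-- Total probability over one measurement, applied after an operator `W`. -/
theorem sum_outcomeProb_mul {A : Type*} [Fintype A] (V : KrausMeasurement d A)
    (W : Matrix (Fin d) (Fin d) ℂ) (ρ : State d) :
    ∑ a, outcomeProb (V.op a * W) ρ = outcomeProb W ρ := by
  have h : ∀ a, (V.op a * W * ρ.mat * (V.op a * W)ᴴ).trace
      = (((V.op a)ᴴ * V.op a) * (W * ρ.mat * Wᴴ)).trace := by
    intro a
    rw [Matrix.conjTranspose_mul, Matrix.mul_assoc (V.op a)ᴴ, Matrix.trace_mul_comm (V.op a)ᴴ]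
    simp only [Matrix.mul_assoc]
  unfold outcomeProb
  rw [← Complex.re_sum]
  simp_rw [h]
  rw [← Matrix.trace_sum, ← Finset.sum_mul, V.sum_eq_one, Matrix.one_mul]

theorem outcomeProb_one (ρ : State d) : outcomeProb 1 ρ = 1 := by
  simp [outcomeProb, ρ.trace_eq_one]

theorem outcomeProb_mul_update {A : Type*} [Fintype A] (V : KrausMeasurement d A) (a : A)
    (W : Matrix (Fin d) (Fin d) ℂ) (ρ : State d) :
    outcomeProb W ρ * outcomeProb (V.op a) (update W ρ) = outcomeProb (V.op a * W) ρ := by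
  by_cases h : outcomeProb W ρ = 0
  · rw [h, zero_mul]
    have hs := sum_outcomeProb_mul V W ρ
    rw [h, Finset.sum_eq_zero_iff_of_nonneg fun _ _ => outcomeProb_nonneg _ _] at hs
    exact (hs a (Finset.mem_univ a)).symm
  · have hu : (update W ρ).mat = ((outcomeProb W ρ : ℝ) : ℂ)⁻¹ • (W * ρ.mat * Wᴴ) := by
      simp [update, h]
    have hm : V.op a * W * ρ.mat * (V.op a * W)ᴴ = V.op a * (W * ρ.mat * Wᴴ) * (V.op a)ᴴ := by
      simp only [Matrix.conjTranspose_mul, Matrix.mul_assoc]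
    rw [outcomeProb.eq_1 (V.op a), outcomeProb.eq_1 (V.op a * W), hm, hu, Matrix.mul_smul, Matrix.smul_mul,
      Matrix.trace_smul, smul_eq_mul, ← Complex.ofReal_inv, Complex.re_ofReal_mul]
    field_simp

section Trajectory

variable {A : Type*} [Fintype A]

/-- The law on `A` of the outcome when `V` is measured in the state `ρ`: the outcome `a` has
probability `tr (V a ρ (V a)†)`. -/
def outcomeLaw [MeasurableSpace A] (V : KrausMeasurement d A) (ρ : State d) : Measure A :=
  ∑ a, ENNReal.ofReal (outcomeProb (V.op a) ρ) • Measure.dirac a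

instance [MeasurableSpace A] (V : KrausMeasurement d A) (ρ : State d) :
    IsProbabilityMeasure (outcomeLaw V ρ) := by
  constructor
  have h := sum_outcomeProb_mul V 1 ρ
  simp only [mul_one, outcomeProb_one] at h
  simp only [outcomeLaw, Measure.coe_finsetSum, Measure.smul_apply, Finset.sum_apply,
    measure_univ, smul_eq_mul, mul_one]
  rw [← ENNReal.ofReal_sum_of_nonneg fun a _ => outcomeProb_nonneg _ _, h, ENNReal.ofReal_one]

variable {Ω : Type*} [MeasurableSpace Ω]

/-- The product `V^{(n)}_{a;ω} = V_{a_n;θ^n ω} ⋯ V_{a_2;θ^2 ω} V_{a_1;θ ω}` (the entry `a_{k+1}` is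
`a k`). -/
def krausProd (V : DisorderedMeasurement Ω d A) (θ : Ω → Ω) (ω : Ω) :
    (n : ℕ) → (Fin n → A) → Matrix (Fin d) (Fin d) ℂ
  | 0, _ => 1
  | n + 1, a => (V.meas (θ^[n + 1] ω)).op (a (Fin.last n)) *
      krausProd V θ ω n (fun i => a i.castSucc)

/-- The quantum trajectory `ρ^{(n)} = V^{(n)}_{a;ω} · ρ` after the outcomes `a_1, …, a_n`. -/
def trajState (V : DisorderedMeasurement Ω d A) (θ : Ω → Ω) (ω : Ω) (ρ : State d) (n : ℕ)
    (a : Fin n → A) : State d :=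
  update (krausProd V θ ω n a) ρ

variable [MeasurableSpace A] [MeasurableSingletonClass A]

/-- The conditional law of the outcome `a_{n+2}` (at index `n + 1`) given `a_1, …, a_{n+1}`. -/
def nextOutcome (V : DisorderedMeasurement Ω d A) (θ : Ω → Ω) (ω : Ω) (ρ : State d) (n : ℕ) :
    Kernel (Finset.Iic n → A) A :=
  Kernel.ofFunOfCountable fun x =>
    outcomeLaw (V.meas (θ^[n + 2] ω))
      (trajState V θ ω ρ (n + 1) fun i => x ⟨i, Finset.mem_Iic.2 (Nat.lt_succ_iff.1 i.2)⟩)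

instance (V : DisorderedMeasurement Ω d A) (θ : Ω → Ω) (ω : Ω) (ρ : State d) (n : ℕ) :
    IsMarkovKernel (nextOutcome V θ ω ρ n) :=
  ⟨fun _ => inferInstanceAs (IsProbabilityMeasure (outcomeLaw _ _))⟩

/-- The quantum probability `ℚ_{ρ;ω}` on the sequences of outcomes `A^ℕ`. It is the probability
measure with `ℚ_{ρ;ω}(a_1, …, a_n) = tr (V^{(n)}_{a;ω} ρ V^{(n)†}_{a;ω})` for all `n`, as
`quantumProb_cylinder` below shows. -/
def quantumProb (V : DisorderedMeasurement Ω d A) (θ : Ω → Ω) (ω : Ω) (ρ : State d) :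
    Measure (ℕ → A) :=
  Kernel.trajMeasure (X := fun _ => A) (outcomeLaw (V.meas (θ ω)) ρ) (nextOutcome V θ ω ρ)

instance (V : DisorderedMeasurement Ω d A) (θ : Ω → Ω) (ω : Ω) (ρ : State d) :
    IsProbabilityMeasure (quantumProb V θ ω ρ) := by
  unfold quantumProb; infer_instance

theorem outcomeLaw_singleton (V : KrausMeasurement d A) (ρ : State d) (a : A) :
    outcomeLaw V ρ {a} = ENNReal.ofReal (outcomeProb (V.op a) ρ) := by
  classical
  simp only [outcomeLaw, Measure.coe_finsetSum, Measure.smul_apply, Finset.sum_apply,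
    Measure.dirac_apply, smul_eq_mul]
  rw [Finset.sum_eq_single a]
  · simp
  · intro b _ hb
    simp [hb]
  · simp

/-- The cylinder probabilities, which characterize `quantumProb`. -/
theorem quantumProb_cylinder (V : DisorderedMeasurement Ω d A) (θ : Ω → Ω) (ω : Ω) (ρ : State d)
    (n : ℕ) (a : Fin n → A) :
    quantumProb V θ ω ρ {x | ∀ i : Fin n, x i = a i} =
      ENNReal.ofReal (outcomeProb (krausProd V θ ω n a) ρ) := by
  induction n with
  | zero => simp [krausProd, outcomeProb_one]
  | succ n ih =>
    have hle := outcomeProb_mul_update (V.meas (θ^[n + 1] ω)) (a (Fin.last n))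
      (krausProd V θ ω n fun i => a i.castSucc) ρ
    change _ = ENNReal.ofReal (outcomeProb ((V.meas (θ^[n + 1] ω)).op (a (Fin.last n)) *
      krausProd V θ ω n fun i => a i.castSucc) ρ)
    rw [← hle, ENNReal.ofReal_mul (outcomeProb_nonneg _ _), ← ih, ← outcomeLaw_singleton]
    rcases n with _ | n
    · have hu : update 1 ρ = ρ := by
        obtain ⟨r, h1, h2⟩ := ρ
        simp [update, outcomeProb, h2]
      have h0 : (quantumProb V θ ω ρ).map (fun x : ℕ → A => x 0) = outcomeLaw (V.meas (θ ω)) ρ := by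
        have h1 : (fun x : ℕ → A => x 0) =
            (MeasurableEquiv.piUnique (fun _ : Finset.Iic 0 => A)) ∘
              Preorder.frestrictLe (π := fun _ => A) 0 := rfl
        rw [h1, ← Measure.map_map (MeasurableEquiv.measurable _) (by fun_prop), quantumProb,
          Kernel.trajMeasure, Measure.map_comp _ _ (by fun_prop), Kernel.traj_map_frestrictLe,
          Kernel.partialTraj_self, Measure.id_comp]
        exact (MeasurableEquiv.piUnique (fun _ : Finset.Iic 0 => A)).map_map_symm
      have h2 : {x : ℕ → A | ∀ i : Fin (0 + 1), x i = a i} = (fun x : ℕ → A => x 0) ⁻¹' {a 0} := by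
        ext x
        simp [Fin.forall_fin_one]
      rw [h2, ← Measure.map_apply (measurable_pi_apply 0) (measurableSet_singleton _), h0]
      simp [krausProd, hu]
    · have hk := Kernel.map_frestrictLe_trajMeasure_compProd_eq_map_trajMeasure (X := fun _ => A)
        (μ₀ := outcomeLaw (V.meas (θ ω)) ρ) (κ := nextOutcome V θ ω ρ) (a := n)
      let h : Finset.Iic n → A := fun i => a ⟨i.1, by have := Finset.mem_Iic.1 i.2; omega⟩
      have hk' := congrArg (fun m => m ({h} ×ˢ {a (Fin.last (n + 1))})) hk
      rw [Measure.compProd_apply_prod (measurableSet_singleton _) (measurableSet_singleton _),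
        lintegral_singleton, Measure.map_apply (by fun_prop) (measurableSet_singleton _),
        Measure.map_apply (by fun_prop)
          ((measurableSet_singleton _).prod (measurableSet_singleton _)), mul_comm] at hk'
      have e1 : {x : ℕ → A | ∀ i : Fin (n + 1 + 1), x i = a i} =
          (fun x : ℕ → A => (Preorder.frestrictLe (π := fun _ => A) n x, x (n + 1))) ⁻¹'
            ({h} ×ˢ {a (Fin.last (n + 1))}) := by
        ext x
        simp only [Set.mem_ofPred_eq, Set.mem_preimage, Set.mem_prod, Set.mem_singleton_iff,
          funext_iff, h]
        rw [Fin.forall_fin_succ']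
        refine and_congr ⟨fun hx i => ?_, fun hx i => ?_⟩ Iff.rfl
        · exact hx ⟨i.1, Nat.lt_succ_iff.2 (Finset.mem_Iic.1 i.2)⟩
        · exact hx ⟨i.1, Finset.mem_Iic.2 (Nat.lt_succ_iff.1 i.2)⟩
      have e2 : {x : ℕ → A | ∀ i : Fin (n + 1), x i = a i.castSucc} =
          Preorder.frestrictLe (π := fun _ => A) n ⁻¹' {h} := by
        ext x
        simp only [Set.mem_ofPred_eq, Set.mem_preimage, Set.mem_singleton_iff, funext_iff, h]
        refine ⟨fun hx i => ?_, fun hx i => ?_⟩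
        · exact hx ⟨i.1, Nat.lt_succ_iff.2 (Finset.mem_Iic.1 i.2)⟩
        · exact hx ⟨i.1, Finset.mem_Iic.2 (Nat.lt_succ_iff.1 i.2)⟩
      rw [e1, e2]
      exact hk'.symm

end Trajectory

section Ensemble

variable {A : Type*} [Fintype A] [MeasurableSpace A] [MeasurableSingletonClass A]
variable {Ω : Type*} [MeasurableSpace Ω]

/-- The moment `M^{(m,n)}_{ρ;ω} = tr ((ρ^{(n)})^m)`. -/
def moment (V : DisorderedMeasurement Ω d A) (θ : Ω → Ω) (ω : Ω) (ρ : State d) (m n : ℕ)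
    (a : ℕ → A) : ℝ :=
  (((trajState V θ ω ρ n fun i => a i).mat) ^ m).trace.re

/-- The purification event: the disorder realizations `ω` such that, for every initial state,
`tr ((ρ^{(n)})^m) → 1` for all `m ≥ 1`, almost surely for the quantum probability. -/
def purificationEvent (V : DisorderedMeasurement Ω d A) (θ : Ω → Ω) : Set Ω :=
  {ω | ∀ ρ : State d, ∀ m : ℕ, 1 ≤ m →
    ∀ᵐ a ∂(quantumProb V θ ω ρ), Tendsto (fun n => moment V θ ω ρ m n a) atTop (𝓝 1)}

/-- The ensemble asymptotically purifies if the purification event has full probability. -/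
def AsymptoticallyPurifies (V : DisorderedMeasurement Ω d A) (θ : Ω → Ω) (P : Measure Ω) : Prop :=
  ∀ᵐ ω ∂P, ω ∈ purificationEvent V θ

/-- `N`-gray projections of rank `r`. -/
def grayProjectionsOfRank (V : DisorderedMeasurement Ω d A) (θ : Ω → Ω) (ω : Ω) (N r : ℕ) :
    Set (Matrix (Fin d) (Fin d) ℂ) :=
  {p | IsStarProjection p ∧ p.rank = r ∧ ∀ a : Fin N → A, ∃ l ∈ Set.Icc (0 : ℝ) 1,
    p * (krausProd V θ ω N a)ᴴ * krausProd V θ ω N a * p = (l : ℂ) • p}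

/-- `N`-gray projections: those of some rank `2 ≤ r ≤ d`. -/
def grayProjections (V : DisorderedMeasurement Ω d A) (θ : Ω → Ω) (ω : Ω) (N : ℕ) :
    Set (Matrix (Fin d) (Fin d) ℂ) :=
  ⋃ r ∈ Set.Icc 2 d, grayProjectionsOfRank V θ ω N r

/-- Dark projections (of rank at least two); the range of a dark projection is a dark subspace. -/
def darkProjections (V : DisorderedMeasurement Ω d A) (θ : Ω → Ω) (ω : Ω) :
    Set (Matrix (Fin d) (Fin d) ℂ) :=
  ⋂ N ≥ 1, grayProjections V θ ω N

end Ensemble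

end QTraj
end

namespace QTraj

/-! The proof measures mixedness by area. For a `d × 2` matrix `X`, `wedge X` is the square root of
the Gram determinant of its columns. When one measurement is made, the areas of the images `V a * X`
add up to at most the area of `X`: after a change of basis `X` is an isometry, and AM-GM gives `√det
G ≤ tr G / 2` for each Gram matrix, while these half-traces sum to 1. Equality forces every Gram
matrix to be scalar, which says exactly that the plane spanned by `X` is dark.

Hence the total area over words of length `n` decreases in `n`. Since the isometries form a compact
set, either some plane keeps area 1 forever, and is dark, or some length `m` contracts all areas by
a factor less than 1 (`darkProjections_eq_empty_iff`). If the second case has positive probability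
for some `m`, ergodicity and recurrence make it happen infinitely often along almost every orbit, so
every total area tends to 0 (`ae_tendsto_wordSum_wedge`).

Write `ρ = B * Bᴴ`. The areas of the pairs of columns of `V⁽ⁿ⁾ * B`, summed and divided by the
probability of the observed word, form a nonnegative supermartingale whose mean is bounded by a
finite sum of total areas, hence tends to 0. It therefore tends to 0 almost surely, and its square
dominates `1 - tr (ρ⁽ⁿ⁾ ^ 2)`; the other moments follow. Conversely, the uniform state on a dark
plane has purity 1/2 forever. -/

/-! ### Positive semidefinite 2 × 2 matrices -/

theorem exists_eq_conjTranspose_mul_self {n : ℕ} {G : Matrix (Fin n) (Fin n) ℂ}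
    (hG : G.PosSemidef) : ∃ B : Matrix (Fin n) (Fin n) ℂ, G = Bᴴ * B := by
  open scoped MatrixOrder Matrix.Norms.L2Operator in
  exact CStarAlgebra.nonneg_iff_eq_star_mul_self.1 hG.nonneg

theorem PosSemidef.norm_det_fin_two {G : Matrix (Fin 2) (Fin 2) ℂ} (hG : G.PosSemidef) :
    ‖G.det‖ = (G 0 0).re * (G 1 1).re - Complex.normSq (G 0 1) := by
  have h0 := Complex.le_def.1 (hG.diag_nonneg (i := 0))
  have h1 := Complex.le_def.1 (hG.diag_nonneg (i := 1))
  have h10 : G 1 0 = star (G 0 1) := (hG.1.apply 1 0).symm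
  have e0 : G 0 0 = ((G 0 0).re : ℂ) := Complex.ext rfl (by simpa using h0.2.symm)
  have e1 : G 1 1 = ((G 1 1).re : ℂ) := Complex.ext rfl (by simpa using h1.2.symm)
  have hdet : G.det = (((G 0 0).re * (G 1 1).re - Complex.normSq (G 0 1) : ℝ) : ℂ) := by
    rw [Matrix.det_fin_two, h10, e0, e1]
    push_cast
    rw [← Complex.mul_conj]
    simp
  have hpos := hG.det_nonneg
  rw [hdet, Complex.zero_le_real] at hpos
  rw [hdet, Complex.norm_real, Real.norm_of_nonneg hpos]

/-- AM-GM for the two eigenvalues, in terms of the entries; `eq_smul_one_of_trace_le` is its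
equality case. -/
theorem sqrt_norm_det_le {G : Matrix (Fin 2) (Fin 2) ℂ} (hG : G.PosSemidef) :
    √‖G.det‖ ≤ G.trace.re / 2 := by
  have h0 := (Complex.le_def.1 (hG.diag_nonneg (i := 0))).1
  have h1 := (Complex.le_def.1 (hG.diag_nonneg (i := 1))).1
  have hn := Complex.normSq_nonneg (G 0 1)
  simp only [Complex.zero_re] at h0 h1
  rw [PosSemidef.norm_det_fin_two hG, Matrix.trace_fin_two, Complex.add_re]
  refine Real.sqrt_le_iff.2 ⟨by positivity, ?_⟩
  nlinarith [sq_nonneg ((G 0 0).re - (G 1 1).re)]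

theorem eq_smul_one_of_trace_le {G : Matrix (Fin 2) (Fin 2) ℂ} (hG : G.PosSemidef)
    (h : G.trace.re / 2 ≤ √‖G.det‖) : G = ((G.trace.re / 2 : ℝ) : ℂ) • 1 := by
  have h0 := Complex.le_def.1 (hG.diag_nonneg (i := 0))
  have h1 := Complex.le_def.1 (hG.diag_nonneg (i := 1))
  have h10 : G 1 0 = star (G 0 1) := (hG.1.apply 1 0).symm
  have hn := Complex.normSq_nonneg (G 0 1)
  have h0' := h0.1
  have h1' := h1.1
  simp only [Complex.zero_re] at h0' h1'
  rw [PosSemidef.norm_det_fin_two hG, Matrix.trace_fin_two, Complex.add_re] at h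
  have h2 := pow_le_pow_left₀ (by positivity) h 2
  rw [Real.sq_sqrt (PosSemidef.norm_det_fin_two hG ▸ norm_nonneg G.det)] at h2
  have hd : (G 0 0).re = (G 1 1).re := by
    nlinarith [sq_nonneg ((G 0 0).re - (G 1 1).re)]
  have hz : G 0 1 = 0 := Complex.normSq_eq_zero.1 (by
    nlinarith [sq_nonneg ((G 0 0).re - (G 1 1).re)])
  have e0 : G 0 0 = ((G 0 0).re : ℂ) := Complex.ext rfl (by simpa using h0.2.symm)
  have e1 : G 1 1 = ((G 1 1).re : ℂ) := Complex.ext rfl (by simpa using h1.2.symm)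
  have ht : G.trace.re / 2 = (G 0 0).re := by
    rw [Matrix.trace_fin_two, Complex.add_re, ← hd]; ring
  rw [ht]
  ext i j
  fin_cases i <;> fin_cases j
  · simpa using e0
  · simpa using hz
  · simp [h10, hz]
  · simpa [hd] using e1

/-! ### Areas of parallelograms under a measurement -/

variable {d : ℕ}

/-- The area `|x ∧ y|` of the parallelogram spanned by the two columns of `X`. -/
noncomputable def wedge (X : Matrix (Fin d) (Fin 2) ℂ) : ℝ := √‖(Xᴴ * X).det‖

theorem wedge_nonneg (X : Matrix (Fin d) (Fin 2) ℂ) : 0 ≤ wedge X := Real.sqrt_nonneg _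

theorem wedge_sq (X : Matrix (Fin d) (Fin 2) ℂ) : wedge X ^ 2 = ‖(Xᴴ * X).det‖ :=
  Real.sq_sqrt (norm_nonneg _)

theorem continuous_wedge : Continuous (wedge (d := d)) := by
  unfold wedge; fun_prop

theorem wedge_mul_right (X : Matrix (Fin d) (Fin 2) ℂ) (g : Matrix (Fin 2) (Fin 2) ℂ) :
    wedge (X * g) = ‖g.det‖ * wedge X := by
  have h : (X * g)ᴴ * (X * g) = gᴴ * (Xᴴ * X) * g := by
    simp only [Matrix.conjTranspose_mul, Matrix.mul_assoc]
  unfold wedge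
  rw [h, Matrix.det_mul, Matrix.det_mul, Matrix.det_conjTranspose, norm_mul, norm_mul, norm_star,
    mul_right_comm, Real.sqrt_mul (by positivity), Real.sqrt_mul_self (norm_nonneg _)]

theorem wedge_eq_one {X : Matrix (Fin d) (Fin 2) ℂ} (hX : Xᴴ * X = 1) : wedge X = 1 := by
  simp [wedge, hX]

theorem wedge_mul_left_eq_zero (W : Matrix (Fin d) (Fin d) ℂ) {X : Matrix (Fin d) (Fin 2) ℂ}
    (hX : wedge X = 0) : wedge (W * X) = 0 := by
  have h : (Xᴴ * X).det = 0 := norm_eq_zero.1 ((Real.sqrt_eq_zero (norm_nonneg _)).1 hX)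
  obtain ⟨v, hv, hXv⟩ := Matrix.exists_mulVec_eq_zero_iff.2 h
  rw [Matrix.conjTranspose_mul_self_mulVec_eq_zero] at hXv
  have h' : ((W * X)ᴴ * (W * X)).det = 0 := by
    refine Matrix.exists_mulVec_eq_zero_iff.1 ⟨v, hv, ?_⟩
    rw [Matrix.conjTranspose_mul_self_mulVec_eq_zero, ← Matrix.mulVec_mulVec, hXv,
      Matrix.mulVec_zero]
  rw [wedge, h', norm_zero, Real.sqrt_zero]

/-- Polar decomposition: if `Xᴴ * X = Bᴴ * B` with `B` invertible, then `X * B⁻¹` is an isometry.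
The factorization `Y = X * h` records that the range of `Y` lies in that of `X`. -/
theorem exists_isometry_mul {X : Matrix (Fin d) (Fin 2) ℂ} (hX : wedge X ≠ 0) :
    ∃ (Y : Matrix (Fin d) (Fin 2) ℂ) (g h : Matrix (Fin 2) (Fin 2) ℂ),
      Yᴴ * Y = 1 ∧ X = Y * g ∧ Y = X * h := by
  obtain ⟨B, hB⟩ := exists_eq_conjTranspose_mul_self (Matrix.posSemidef_conjTranspose_mul_self X)
  have hd : IsUnit B.det := by
    rw [isUnit_iff_ne_zero]
    intro h
    exact hX (by simp [wedge, hB, Matrix.det_mul, h])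
  refine ⟨X * B⁻¹, B, B⁻¹, ?_, ?_, rfl⟩
  · have hd' : IsUnit Bᴴ.det := by rw [Matrix.det_conjTranspose]; exact hd.star
    have : (X * B⁻¹)ᴴ * (X * B⁻¹) = B⁻¹ᴴ * (Xᴴ * X) * B⁻¹ := by
      simp only [Matrix.conjTranspose_mul, Matrix.mul_assoc]
    rw [this, hB, Matrix.conjTranspose_nonsing_inv, ← Matrix.mul_assoc,
      Matrix.nonsing_inv_mul _ hd', Matrix.one_mul, Matrix.mul_nonsing_inv _ hd]
  · rw [Matrix.mul_assoc, Matrix.nonsing_inv_mul _ hd, Matrix.mul_one]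

theorem sum_trace_gram {ι : Type*} [Fintype ι] {W : ι → Matrix (Fin d) (Fin d) ℂ}
    (hW : ∑ i, (W i)ᴴ * W i = 1) {X : Matrix (Fin d) (Fin 2) ℂ} (hX : Xᴴ * X = 1) :
    ∑ i, (((W i * X)ᴴ * (W i * X)).trace.re / 2) = 1 := by
  have h : ∀ i, (W i * X)ᴴ * (W i * X) = Xᴴ * ((W i)ᴴ * W i) * X := fun i => by
    simp only [Matrix.conjTranspose_mul, Matrix.mul_assoc]
  simp_rw [h]
  rw [← Finset.sum_div, ← Complex.re_sum, ← Matrix.trace_sum, ← Matrix.sum_mul, ← Matrix.mul_sum, hW,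
    Matrix.mul_one, hX]
  simp

/-- Both sides scale by `‖det g‖` under `X ↦ X * g`, so an isometry suffices; there AM-GM applies
term by term and the half-traces sum to 1. -/
theorem sum_wedge_le {ι : Type*} [Fintype ι] {W : ι → Matrix (Fin d) (Fin d) ℂ}
    (hW : ∑ i, (W i)ᴴ * W i = 1) (X : Matrix (Fin d) (Fin 2) ℂ) :
    ∑ i, wedge (W i * X) ≤ wedge X := by
  by_cases hX : wedge X = 0
  · simp [wedge_mul_left_eq_zero _ hX, hX]
  · obtain ⟨Y, g, -, hY, rfl, -⟩ := exists_isometry_mul hX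
    simp_rw [← Matrix.mul_assoc, wedge_mul_right]
    rw [← Finset.mul_sum, wedge_eq_one hY]
    refine mul_le_mul_of_nonneg_left ?_ (norm_nonneg _)
    rw [← sum_trace_gram hW hY]
    exact Finset.sum_le_sum fun i _ =>
      sqrt_norm_det_le (Matrix.posSemidef_conjTranspose_mul_self _)

/-- If no area is lost, each term attains equality in AM-GM. -/
theorem gram_eq_smul_one_of_one_le_sum_wedge {ι : Type*} [Fintype ι]
    {W : ι → Matrix (Fin d) (Fin d) ℂ} (hW : ∑ i, (W i)ᴴ * W i = 1)
    {X : Matrix (Fin d) (Fin 2) ℂ} (hX : Xᴴ * X = 1) (h : 1 ≤ ∑ i, wedge (W i * X)) (i : ι) :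
    ∃ l ∈ Set.Icc (0 : ℝ) 1, (W i * X)ᴴ * (W i * X) = (l : ℂ) • 1 := by
  have hps : ∀ j, ((W j * X)ᴴ * (W j * X)).PosSemidef := fun j =>
    Matrix.posSemidef_conjTranspose_mul_self _
  have hle : ∀ j ∈ Finset.univ, wedge (W j * X) ≤ ((W j * X)ᴴ * (W j * X)).trace.re / 2 :=
    fun j _ => sqrt_norm_det_le (hps j)
  have hsum := sum_trace_gram hW hX
  have heq := (Finset.sum_eq_sum_iff_of_le hle).1
    (le_antisymm (Finset.sum_le_sum hle) (hsum.le.trans h)) i (Finset.mem_univ i)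
  have hnn : ∀ j ∈ Finset.univ, 0 ≤ ((W j * X)ᴴ * (W j * X)).trace.re / 2 :=
    fun j hj => (wedge_nonneg _).trans (hle j hj)
  exact ⟨_, ⟨hnn i (Finset.mem_univ i), hsum ▸ Finset.single_le_sum hnn (Finset.mem_univ i)⟩,
    eq_smul_one_of_trace_le (hps i) heq.ge⟩

/-! ### Total area over words of outcomes -/

section Words

variable {d : ℕ} {A : Type*} [Fintype A] {Ω : Type*} [MeasurableSpace Ω]
variable (V : DisorderedMeasurement Ω d A) (θ : Ω → Ω)

theorem sum_words_succ {M : Type*} [AddCommMonoid M] {n : ℕ} (F : (Fin (n + 1) → A) → M) :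
    ∑ a, F a = ∑ a : Fin n → A, ∑ b, F (Fin.snoc (α := fun _ => A) a b) := by
  rw [← (Fin.snocEquiv fun _ : Fin (n + 1) => A).sum_comp, Fintype.sum_prod_type_right]
  rfl

theorem krausProd_snoc (ω : Ω) (n : ℕ) (a : Fin n → A) (b : A) :
    krausProd V θ ω (n + 1) (Fin.snoc (α := fun _ => A) a b) =
      (V.meas (θ^[n + 1] ω)).op b * krausProd V θ ω n a := by
  simp [krausProd]

theorem sum_krausProd_eq_one (ω : Ω) (n : ℕ) :
    ∑ a, (krausProd V θ ω n a)ᴴ * krausProd V θ ω n a = 1 := by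
  induction n with
  | zero => simp [krausProd]
  | succ n ih =>
    rw [sum_words_succ, ← ih]
    refine Finset.sum_congr rfl fun a _ => ?_
    have h : ∀ b, (krausProd V θ ω (n + 1) (Fin.snoc (α := fun _ => A) a b))ᴴ *
        krausProd V θ ω (n + 1) (Fin.snoc (α := fun _ => A) a b) =
        (krausProd V θ ω n a)ᴴ * (((V.meas (θ^[n + 1] ω)).op b)ᴴ *
          (V.meas (θ^[n + 1] ω)).op b) * krausProd V θ ω n a := fun b => by
      rw [krausProd_snoc, Matrix.conjTranspose_mul]
      simp only [Matrix.mul_assoc]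
    simp_rw [h]
    rw [← Finset.sum_mul, ← Finset.mul_sum, KrausMeasurement.sum_eq_one, Matrix.mul_one]

/-- The sum of `f (V^{(n)}_{a;ω} X)` over all words `a` of length `n`. -/
noncomputable def wordSum (ω : Ω) (n : ℕ) (f : Matrix (Fin d) (Fin 2) ℂ → ℝ)
    (X : Matrix (Fin d) (Fin 2) ℂ) : ℝ :=
  ∑ a : Fin n → A, f (krausProd V θ ω n a * X)

theorem wordSum_succ (ω : Ω) (n : ℕ) (f : Matrix (Fin d) (Fin 2) ℂ → ℝ) :
    wordSum V θ ω (n + 1) f =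
      wordSum V θ ω n fun Y => ∑ b, f ((V.meas (θ^[n + 1] ω)).op b * Y) := by
  funext X
  simp only [wordSum, sum_words_succ, krausProd_snoc, Matrix.mul_assoc]

theorem wordSum_add (ω : Ω) (n m : ℕ) (f : Matrix (Fin d) (Fin 2) ℂ → ℝ) :
    wordSum V θ ω (n + m) f = wordSum V θ ω n (wordSum V θ (θ^[n] ω) m f) := by
  induction m generalizing f with
  | zero =>
    congr 1
    funext X
    simp [wordSum, krausProd]
  | succ m ih =>
    have h : θ^[n + m + 1] ω = θ^[m + 1] (θ^[n] ω) := by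
      rw [← Function.iterate_add_apply, show m + 1 + n = n + m + 1 by omega]
    rw [← Nat.add_assoc, wordSum_succ, ih, wordSum_succ, h]

theorem wordSum_mono (ω : Ω) (n : ℕ) {f g : Matrix (Fin d) (Fin 2) ℂ → ℝ} (h : ∀ Y, f Y ≤ g Y)
    (X : Matrix (Fin d) (Fin 2) ℂ) : wordSum V θ ω n f X ≤ wordSum V θ ω n g X :=
  Finset.sum_le_sum fun _ _ => h _

theorem wordSum_wedge_nonneg (ω : Ω) (n : ℕ) (X : Matrix (Fin d) (Fin 2) ℂ) :
    0 ≤ wordSum V θ ω n wedge X :=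
  Finset.sum_nonneg fun _ _ => wedge_nonneg _

theorem wordSum_wedge_antitone (ω : Ω) (X : Matrix (Fin d) (Fin 2) ℂ) :
    Antitone fun n => wordSum V θ ω n wedge X := by
  refine antitone_nat_of_succ_le fun n => ?_
  rw [wordSum_succ]
  exact wordSum_mono V θ ω n (sum_wedge_le (KrausMeasurement.sum_eq_one _)) X

theorem continuous_wordSum_wedge (ω : Ω) (n : ℕ) : Continuous (wordSum V θ ω n wedge) := by
  unfold wordSum
  refine continuous_finsetSum _ fun a _ => continuous_wedge.comp ?_
  fun_prop

theorem wordSum_wedge_mul_right (ω : Ω) (n : ℕ) (X : Matrix (Fin d) (Fin 2) ℂ)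
    (g : Matrix (Fin 2) (Fin 2) ℂ) :
    wordSum V θ ω n wedge (X * g) = ‖g.det‖ * wordSum V θ ω n wedge X := by
  simp only [wordSum, ← Matrix.mul_assoc, wedge_mul_right, Finset.mul_sum]

theorem wordSum_wedge_le_mul {ω : Ω} {n : ℕ} {c : ℝ}
    (hc : ∀ Y : Matrix (Fin d) (Fin 2) ℂ, Yᴴ * Y = 1 → wordSum V θ ω n wedge Y ≤ c)
    (X : Matrix (Fin d) (Fin 2) ℂ) : wordSum V θ ω n wedge X ≤ c * wedge X := by
  by_cases hX : wedge X = 0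
  · simp [wordSum, wedge_mul_left_eq_zero _ hX, hX]
  · obtain ⟨Y, g, -, hY, rfl, -⟩ := exists_isometry_mul hX
    rw [wordSum_wedge_mul_right, wedge_mul_right, wedge_eq_one hY, mul_one, mul_comm c]
    exact mul_le_mul_of_nonneg_left (hc Y hY) (norm_nonneg _)

/-- The total area decreases to some `L ≥ 0`. Infinitely often, the next `m` outcomes multiply it by
at most `c`, so `L ≤ c * L` and `L = 0`. -/
theorem tendsto_wordSum_wedge {ω : Ω} {m : ℕ} {c : ℝ} (hc : c < 1)
    (h : ∃ᶠ n in atTop, ∀ Y : Matrix (Fin d) (Fin 2) ℂ, Yᴴ * Y = 1 →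
      wordSum V θ (θ^[n] ω) m wedge Y ≤ c) (X : Matrix (Fin d) (Fin 2) ℂ) :
    Tendsto (fun n => wordSum V θ ω n wedge X) atTop (𝓝 0) := by
  have hlim := tendsto_atTop_ciInf (wordSum_wedge_antitone V θ ω X)
    ⟨0, by rintro _ ⟨n, rfl⟩; exact wordSum_wedge_nonneg V θ ω n X⟩
  set L := ⨅ n, wordSum V θ ω n wedge X
  have hL : 0 ≤ L := ge_of_tendsto' hlim fun n => wordSum_wedge_nonneg V θ ω n X
  have hle : ∃ᶠ n in atTop, wordSum V θ ω (n + m) wedge X ≤ c * wordSum V θ ω n wedge X := by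
    refine h.mono fun n hn => ?_
    rw [wordSum_add]
    refine (wordSum_mono V θ ω n (wordSum_wedge_le_mul V θ hn) X).trans_eq ?_
    simp only [wordSum, Finset.mul_sum]
  have hLc : L ≤ c * L := by
    by_contra! hlt
    have := ((hlim.const_mul c).eventually_lt (hlim.comp (tendsto_add_atTop_nat m)) hlt)
    exact hle (this.mono fun n hn => not_le.2 hn)
  have : L = 0 := by nlinarith
  rwa [this] at hlim

/-! ### Compactness: uniform contraction or a plane of constant area -/

theorem norm_apply_le_one {X : Matrix (Fin d) (Fin 2) ℂ} (hX : Xᴴ * X = 1) (i : Fin d)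
    (j : Fin 2) : ‖X i j‖ ≤ 1 := by
  have h := congrArg (fun M : Matrix (Fin 2) (Fin 2) ℂ => (M j j).re) hX
  simp only [Matrix.mul_apply, Matrix.conjTranspose_apply, Matrix.one_apply_eq, Complex.one_re,
    Complex.re_sum] at h
  have hterm : ∀ k, (star (X k j) * X k j).re = ‖X k j‖ ^ 2 := fun k => by
    rw [← Complex.normSq_eq_norm_sq, Complex.normSq_apply]; simp
  simp_rw [hterm] at h
  have := Finset.single_le_sum (f := fun k => ‖X k j‖ ^ 2) (fun k _ => sq_nonneg _)
    (Finset.mem_univ i)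
  exact (sq_le_one_iff₀ (norm_nonneg _)).1 (this.trans_eq h)

theorem isCompact_isometries (d : ℕ) :
    IsCompact {X : Matrix (Fin d) (Fin 2) ℂ | Xᴴ * X = 1} := by
  have hK : IsCompact (Set.univ.pi fun _ : Fin d => Set.univ.pi fun _ : Fin 2 =>
      Metric.closedBall (0 : ℂ) 1) :=
    isCompact_univ_pi fun _ => isCompact_univ_pi fun _ => isCompact_closedBall 0 1
  exact hK.of_isClosed_subset (isClosed_eq (by fun_prop) continuous_const)
    fun X hX i _ j _ => mem_closedBall_zero_iff.2 (norm_apply_le_one hX i j)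

theorem measurable_krausProd_apply {θ : Ω → Ω} (hθ : Measurable θ) (n : ℕ) (a : Fin n → A)
    (i j : Fin d) : Measurable fun ω => krausProd V θ ω n a i j := by
  induction n generalizing i j with
  | zero => exact measurable_const
  | succ n ih =>
    simp only [krausProd, Matrix.mul_apply]
    exact Finset.measurable_fun_sum _ fun k _ =>
      ((V.measurable_entry _ _ _).comp (hθ.iterate _)).mul (ih _ _ _)

theorem measurable_wordSum_wedge {θ : Ω → Ω} (hθ : Measurable θ) (n : ℕ)
    (X : Matrix (Fin d) (Fin 2) ℂ) : Measurable fun ω => wordSum V θ ω n wedge X := by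
  unfold wordSum wedge
  refine Finset.measurable_fun_sum _ fun a _ => (Measurable.norm ?_).sqrt
  have := measurable_krausProd_apply V hθ n a
  simp only [Matrix.det_fin_two, Matrix.mul_apply, Matrix.conjTranspose_apply]
  fun_prop

/-- The disorder realizations for which the words of length `m` contract all areas by the factor
`1 - 1 / (m + 1)`. -/
def contractingEvent (m : ℕ) : Set Ω :=
  {ω | ∀ X : Matrix (Fin d) (Fin 2) ℂ, Xᴴ * X = 1 →
    wordSum V θ ω m wedge X ≤ 1 - 1 / ((m : ℝ) + 1)}

theorem measurableSet_contractingEvent {θ : Ω → Ω} (hθ : Measurable θ) (m : ℕ) :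
    MeasurableSet (contractingEvent V θ m) := by
  have : SecondCountableTopology (Matrix (Fin d) (Fin 2) ℂ) :=
    inferInstanceAs (SecondCountableTopology (Fin d → Fin 2 → ℂ))
  obtain ⟨S, hS, hSd⟩ := TopologicalSpace.exists_countable_dense
    {X : Matrix (Fin d) (Fin 2) ℂ | Xᴴ * X = 1}
  -- The condition on `X` is closed, so a countable dense set of isometries decides it.
  have h : contractingEvent V θ m =
      ⋂ X ∈ S, {ω | wordSum V θ ω m wedge X.1 ≤ 1 - 1 / ((m : ℝ) + 1)} := by
    ext ω
    simp only [contractingEvent, Set.mem_iInter, Set.mem_ofPred_eq]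
    refine ⟨fun h X _ => h X.1 X.2, fun h X hX => ?_⟩
    let T := {Y : {X : Matrix (Fin d) (Fin 2) ℂ | Xᴴ * X = 1} |
        wordSum V θ ω m wedge Y.1 ≤ 1 - 1 / ((m : ℝ) + 1)}
    have hcl : IsClosed T :=
      isClosed_le ((continuous_wordSum_wedge V θ ω m).comp continuous_subtype_val)
        continuous_const
    have hST : S ⊆ T := fun Y hY => h Y hY
    have hmem : (⟨X, hX⟩ : {X : Matrix (Fin d) (Fin 2) ℂ | Xᴴ * X = 1}) ∈ T :=
      closure_minimal hST hcl (hSd _)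
    exact hmem
  rw [h]
  exact MeasurableSet.biInter hS fun X _ =>
    measurableSet_le (measurable_wordSum_wedge V hθ m X.1) measurable_const

/-- Cantor intersection: the sets `K m` are compact, nonempty and nested, because the area decreases
in `m` while the threshold `1 - 1 / (m + 1)` increases. For a common point the area at time `n` is
at least every threshold with `m ≥ n`, and these tend to 1. -/
theorem exists_isometry_wordSum_of_forall_notMem {ω : Ω}
    (h : ∀ m, ω ∉ contractingEvent V θ m) :
    ∃ X : Matrix (Fin d) (Fin 2) ℂ, Xᴴ * X = 1 ∧ ∀ n, 1 ≤ wordSum V θ ω n wedge X := by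
  let K : ℕ → Set (Matrix (Fin d) (Fin 2) ℂ) := fun m =>
    {X | Xᴴ * X = 1} ∩ {X | 1 - 1 / ((m : ℝ) + 1) ≤ wordSum V θ ω m wedge X}
  have hclosed : ∀ m : ℕ, IsClosed {X | 1 - 1 / ((m : ℝ) + 1) ≤ wordSum V θ ω m wedge X} := fun m =>
    isClosed_le continuous_const (continuous_wordSum_wedge V θ ω m)
  obtain ⟨X, hX⟩ := IsCompact.nonempty_iInter_of_sequence_nonempty_isCompact_isClosed K
    (fun m X hX => ⟨hX.1, by
      have h1 := wordSum_wedge_antitone V θ ω X (Nat.le_succ m)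
      have h2 := hX.2
      have h3 := Nat.one_div_le_one_div (α := ℝ) (Nat.le_succ m)
      simp only [Set.mem_ofPred_eq, Nat.succ_eq_add_one] at h1 h2 h3 ⊢
      linarith⟩)
    (fun m => by
      have := h m
      simp only [contractingEvent, Set.mem_ofPred_eq, not_forall, not_le] at this
      obtain ⟨X, hX, hlt⟩ := this
      exact ⟨X, hX, hlt.le⟩)
    ((isCompact_isometries d).inter_right (hclosed 0))
    (fun m => (isCompact_isometries d).isClosed.inter (hclosed m))
  rw [Set.mem_iInter] at hX
  refine ⟨X, (hX 0).1, fun n => ?_⟩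
  have hlim : Tendsto (fun m : ℕ => 1 - 1 / ((m : ℝ) + 1)) atTop (𝓝 (1 - 0)) :=
    tendsto_one_div_add_atTop_nhds_zero_nat.const_sub 1
  rw [sub_zero] at hlim
  refine le_of_tendsto hlim (eventually_atTop.2 ⟨n, fun m hm => ?_⟩)
  exact (hX m).2.trans (wordSum_wedge_antitone V θ ω X hm)

end Words

/-! ### Dark projections in terms of areas -/

theorem trace_eq_rank_of_isIdempotentElem {d : ℕ} {p : Matrix (Fin d) (Fin d) ℂ}
    (hp : IsIdempotentElem p) : p.trace = p.rank := by
  have h : IsIdempotentElem (Matrix.toLin' p) := by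
    rw [IsIdempotentElem, Module.End.mul_eq_comp, ← Matrix.toLin'_mul, hp.eq]
  rw [← Matrix.trace_toLin'_eq, (LinearMap.IsIdempotentElem.isProj_range _ h).trace]
  rfl

/-- Each squared area is a 2 × 2 principal minor of `Cᴴ * C`. The identity serves twice: it finds a
nondegenerate pair of columns in a projection of rank at least 2, and it expresses the purity defect
of a state through areas. -/
theorem sum_wedge_sq {d : ℕ} (C : Matrix (Fin d) (Fin d) ℂ) :
    ∑ k, ∑ l, wedge (C.submatrix id ![k, l]) ^ 2 =
      (C * Cᴴ).trace.re ^ 2 - ((C * Cᴴ) * (C * Cᴴ)).trace.re := by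
  have h1 : (C * Cᴴ).trace = (Cᴴ * C).trace := Matrix.trace_mul_comm _ _
  have h2 : ((C * Cᴴ) * (C * Cᴴ)).trace = ((Cᴴ * C) * (Cᴴ * C)).trace := by
    rw [Matrix.mul_assoc, Matrix.trace_mul_comm]
    simp only [Matrix.mul_assoc]
  have h3 : ∀ k l, (Cᴴ * C) l k = star ((Cᴴ * C) k l) := fun k l =>
    ((Matrix.isHermitian_conjTranspose_mul_self C).apply l k).symm
  have h4 : ∀ k l, wedge (C.submatrix id ![k, l]) ^ 2 =
      ((Cᴴ * C) k k).re * ((Cᴴ * C) l l).re - Complex.normSq ((Cᴴ * C) k l) := fun k l => by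
    rw [wedge_sq, PosSemidef.norm_det_fin_two (Matrix.posSemidef_conjTranspose_mul_self _)]
    rfl
  have h5 : ∀ k l, ((Cᴴ * C) k l * (Cᴴ * C) l k).re = Complex.normSq ((Cᴴ * C) k l) :=
    fun k l => by
      rw [h3 k l]
      exact congrArg Complex.re (Complex.mul_conj _)
  rw [h1, h2]
  simp_rw [h4, Finset.sum_sub_distrib, ← Finset.mul_sum, ← Finset.sum_mul]
  congr 1
  · simp only [Matrix.trace, Matrix.diag_apply, Complex.re_sum, sq]
  · simp only [Matrix.trace, Matrix.diag_apply, Matrix.mul_apply (M := Cᴴ * C) (N := Cᴴ * C),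
      Complex.re_sum, h5]

section Dark

variable {d : ℕ} {A : Type*} [Fintype A] {Ω : Type*} [MeasurableSpace Ω]
variable (V : DisorderedMeasurement Ω d A) (θ : Ω → Ω)

theorem mul_conjTranspose_mem_darkProjections {ω : Ω} {X : Matrix (Fin d) (Fin 2) ℂ}
    (hX : Xᴴ * X = 1) (h : ∀ n, 1 ≤ wordSum V θ ω n wedge X) :
    X * Xᴴ ∈ darkProjections V θ ω := by
  have hrank : (X * Xᴴ).rank = 2 := by
    rw [Matrix.rank_self_mul_conjTranspose, ← Matrix.rank_conjTranspose_mul_self, hX,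
      Matrix.rank_one, Fintype.card_fin]
  have hd : 2 ≤ d := by
    have := (X * Xᴴ).rank_le_card_width
    rwa [hrank, Fintype.card_fin] at this
  simp only [darkProjections, grayProjections, Set.mem_iInter, Set.mem_iUnion]
  refine fun n _ => ⟨2, ⟨le_rfl, hd⟩, ⟨?_, ?_⟩, hrank, fun a => ?_⟩
  · rw [IsIdempotentElem, Matrix.mul_assoc, ← Matrix.mul_assoc Xᴴ, hX, Matrix.one_mul]
  · exact Matrix.isHermitian_mul_conjTranspose_self X
  · obtain ⟨l, hl, hG⟩ :=
      gram_eq_smul_one_of_one_le_sum_wedge (sum_krausProd_eq_one V θ ω n) hX (h n) a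
    refine ⟨l, hl, ?_⟩
    have : X * Xᴴ * (krausProd V θ ω n a)ᴴ * krausProd V θ ω n a * (X * Xᴴ) =
        X * ((krausProd V θ ω n a * X)ᴴ * (krausProd V θ ω n a * X)) * Xᴴ := by
      simp only [Matrix.conjTranspose_mul, Matrix.mul_assoc]
    rw [this, hG, Matrix.mul_smul, Matrix.mul_one, Matrix.smul_mul]

/-- Every plane inside a dark subspace inherits the scalar Gram matrices, so planes are enough. -/
theorem exists_isometry_of_mem_darkProjections {ω : Ω} {p : Matrix (Fin d) (Fin d) ℂ}
    (hp : p ∈ darkProjections V θ ω) :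
    ∃ X : Matrix (Fin d) (Fin 2) ℂ, Xᴴ * X = 1 ∧ ∀ n (a : Fin n → A), ∃ l : ℝ, 0 ≤ l ∧
      (krausProd V θ ω n a * X)ᴴ * (krausProd V θ ω n a * X) = (l : ℂ) • 1 := by
  simp only [darkProjections, grayProjections, Set.mem_iInter, Set.mem_iUnion] at hp
  obtain ⟨r, hr, hstar, hrank, -⟩ := hp 1 le_rfl
  have hself : pᴴ = p := hstar.isSelfAdjoint
  have hidem : p * p = p := hstar.isIdempotentElem
  have htr : p.trace = (r : ℂ) := by
    rw [trace_eq_rank_of_isIdempotentElem hstar.isIdempotentElem, hrank]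
  have hsum := sum_wedge_sq p
  rw [hself, hidem, hidem, htr, Complex.natCast_re] at hsum
  have hr2 : (2 : ℝ) ≤ r := by exact_mod_cast hr.1
  -- The squared areas of pairs of columns of `p` sum to `r ^ 2 - r > 0`, so some pair is
  -- independent.
  obtain ⟨k, -, hk⟩ := Finset.exists_ne_zero_of_sum_ne_zero
    (hsum.trans_ne (by nlinarith : (r : ℝ) ^ 2 - r ≠ 0))
  obtain ⟨l, -, hl⟩ := Finset.exists_ne_zero_of_sum_ne_zero hk
  obtain ⟨X, g, h, hX, -, hXp⟩ := exists_isometry_mul (pow_ne_zero_iff two_ne_zero |>.1 hl)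
  have hpc : p * p.submatrix id ![k, l] = p.submatrix id ![k, l] := by
    conv_rhs => rw [← hidem]
    rw [Matrix.submatrix_mul p p id id ![k, l] Function.bijective_id, Matrix.submatrix_id_id]
  have hpX : p * X = X := by rw [hXp, ← Matrix.mul_assoc, hpc]
  refine ⟨X, hX, fun n a => ?_⟩
  -- Darkness only concerns `n ≥ 1`; the empty word acts as the identity.
  rcases Nat.eq_zero_or_pos n with rfl | hn
  · exact ⟨1, zero_le_one, by simp [krausProd, hX]⟩
  · obtain ⟨_, -, -, -, hgray⟩ := hp n hn
    obtain ⟨l, hl, hG⟩ := hgray a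
    refine ⟨l, hl.1, ?_⟩
    have : (krausProd V θ ω n a * X)ᴴ * (krausProd V θ ω n a * X) =
        Xᴴ * (p * (krausProd V θ ω n a)ᴴ * krausProd V θ ω n a * p) * X := by
      conv_lhs => rw [← hpX]
      simp only [Matrix.conjTranspose_mul, Matrix.mul_assoc, hself]
    rw [this, hG, Matrix.mul_smul, Matrix.smul_mul, Matrix.mul_assoc, hpX, hX]

theorem darkProjections_eq_empty_iff (ω : Ω) :
    darkProjections V θ ω = ∅ ↔ ∃ m, ω ∈ contractingEvent V θ m := by
  constructor
  · intro h
    by_contra! hne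
    obtain ⟨X, hX, hw⟩ := exists_isometry_wordSum_of_forall_notMem V θ hne
    exact (h ▸ mul_conjTranspose_mem_darkProjections V θ hX hw : X * Xᴴ ∈ ∅)
  · rintro ⟨m, hm⟩
    refine Set.eq_empty_of_forall_notMem fun p hp => ?_
    obtain ⟨X, hX, hdark⟩ := exists_isometry_of_mem_darkProjections V θ hp
    -- On a dark plane area equals half-trace for each word, so no total area is lost.
    have h1 : wordSum V θ ω m wedge X = 1 := by
      rw [← sum_trace_gram (sum_krausProd_eq_one V θ ω m) hX]
      refine Finset.sum_congr rfl fun a _ => ?_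
      obtain ⟨l, hl, hG⟩ := hdark m a
      rw [wedge, hG]
      simp [Real.sqrt_sq hl, abs_of_nonneg hl]
    have h2 := hm X hX
    rw [h1] at h2
    have : (0 : ℝ) < 1 / ((m : ℝ) + 1) := by positivity
    linarith

theorem measurableSet_darkProjections_eq_empty {θ : Ω → Ω} (hθ : Measurable θ) :
    MeasurableSet {ω | darkProjections V θ ω = ∅} := by
  have h : {ω | darkProjections V θ ω = ∅} = ⋃ m, contractingEvent V θ m := by
    ext ω
    simp [darkProjections_eq_empty_iff]
  rw [h]
  exact MeasurableSet.iUnion (measurableSet_contractingEvent V hθ)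

end Dark

/-! ### Recurrence and almost sure decay of areas -/

/-- The set `F` of points visiting `E` infinitely often is invariant, hence null or conull. Poincaré
recurrence puts almost all of `E` in `F`, so `F` cannot be null. -/
theorem ae_frequently_iterate_mem {Ω : Type*} [MeasurableSpace Ω] {P : Measure Ω}
    [IsFiniteMeasure P] {θ : Ω → Ω} (hθ : Ergodic θ P) {E : Set Ω} (hE : MeasurableSet E)
    (hpos : P E ≠ 0) : ∀ᵐ ω ∂P, ∃ᶠ n in atTop, θ^[n] ω ∈ E := by
  let F : Set Ω := {ω | ∃ᶠ n in atTop, θ^[n] ω ∈ E}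
  have hF : MeasurableSet F := by
    have : F = ⋂ N : ℕ, ⋃ n ≥ N, θ^[n] ⁻¹' E := by
      ext ω
      simp [F, frequently_atTop]
    rw [this]
    exact MeasurableSet.iInter fun N => MeasurableSet.iUnion fun n => MeasurableSet.iUnion fun _ =>
      hE.preimage (hθ.measurable.iterate n)
  have hinv : θ ⁻¹' F = F := by
    ext ω
    change (∃ᶠ n in atTop, θ^[n + 1] ω ∈ E) ↔ ∃ᶠ n in atTop, θ^[n] ω ∈ E
    conv_rhs => rw [← map_add_atTop_eq_nat 1, frequently_map]
  rcases hθ.toPreErgodic.ae_mem_or_ae_notMem hF hinv with h | h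
  · exact h
  · refine absurd ?_ hpos
    have hrec := hθ.toMeasurePreserving.conservative.ae_mem_imp_frequently_image_mem
      hE.nullMeasurableSet
    rw [measure_eq_zero_iff_ae_notMem]
    filter_upwards [h, hrec] with ω h1 h2 h3 using h1 (h2 h3)

theorem ae_tendsto_wordSum_wedge {d : ℕ} {A : Type*} [Fintype A] {Ω : Type*} [MeasurableSpace Ω]
    (V : DisorderedMeasurement Ω d A) {P : Measure Ω} [IsFiniteMeasure P] {θ : Ω → Ω}
    (hθ : Ergodic θ P) (hpos : P {ω | darkProjections V θ ω = ∅} ≠ 0) :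
    ∀ᵐ ω ∂P, ∀ X, Tendsto (fun n => wordSum V θ ω n wedge X) atTop (𝓝 0) := by
  have h : {ω | darkProjections V θ ω = ∅} = ⋃ m, contractingEvent V θ m := by
    ext ω
    simp [darkProjections_eq_empty_iff]
  -- A countable union of positive measure has a member of positive measure, which fixes one length
  -- `m` and one contraction factor.
  rw [h, Ne, measure_iUnion_null_iff, not_forall] at hpos
  obtain ⟨m, hm⟩ := hpos
  filter_upwards [ae_frequently_iterate_mem hθ
    (measurableSet_contractingEvent V hθ.measurable m) hm] with ω hω
  exact tendsto_wordSum_wedge V θ (sub_lt_self 1 (by positivity)) hω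

/-! ### Supermartingales of outcomes -/

/-- Doob's theorem, applied to the submartingale `-Z`, gives an almost sure limit. Convergence to 0
in `L¹` gives a subsequence tending to 0 almost surely, which identifies that limit. -/
theorem Supermartingale.ae_tendsto_zero {X : Type*} {m0 : MeasurableSpace X} {Q : Measure X}
    [IsFiniteMeasure Q] {ℱ : Filtration ℕ m0} {Z : ℕ → X → ℝ} (hZ : Supermartingale Z ℱ Q)
    (hnn : ∀ n x, 0 ≤ Z n x) (hlim : Tendsto (fun n => ∫ x, Z n x ∂Q) atTop (𝓝 0)) :
    ∀ᵐ x ∂Q, Tendsto (fun n => Z n x) atTop (𝓝 0) := by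
  have hnorm : ∀ n, eLpNorm (Z n) 1 Q = ENNReal.ofReal (∫ x, Z n x ∂Q) := fun n => by
    rw [eLpNorm_one_eq_lintegral_enorm, ← ofReal_integral_norm_eq_lintegral_enorm (hZ.integrable n)]
    simp_rw [Real.norm_of_nonneg (hnn n _)]
  obtain ⟨R, hR⟩ := hlim.bddAbove_range
  have hbdd : ∀ n, eLpNorm ((-Z) n) 1 Q ≤ (R.toNNReal : ℝ≥0∞) := fun n => by
    rw [Pi.neg_apply, eLpNorm_neg, hnorm]
    exact ENNReal.ofReal_le_ofReal (hR ⟨n, rfl⟩)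
  have hmeas : TendstoInMeasure Q Z atTop 0 := by
    refine tendstoInMeasure_of_tendsto_eLpNorm one_ne_zero
      (fun n => (hZ.integrable n).aestronglyMeasurable) aestronglyMeasurable_const ?_
    simp only [sub_zero, hnorm]
    simpa using ENNReal.tendsto_ofReal hlim
  obtain ⟨ns, hns, hsub⟩ := hmeas.exists_seq_tendsto_ae
  filter_upwards [hZ.neg.exists_ae_tendsto_of_bdd hbdd, hsub] with x ⟨c, hc⟩ hx
  have hc' : Tendsto (fun n => Z n x) atTop (𝓝 (-c)) := by simpa using hc.neg
  have : -c = 0 := tendsto_nhds_unique (hc'.comp hns.tendsto_atTop) hx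
  rwa [this] at hc'

section Trajectory

variable {d : ℕ} {A : Type*} [Fintype A] {Ω : Type*} [MeasurableSpace Ω]
variable [MeasurableSpace A] [MeasurableSingletonClass A]
variable (V : DisorderedMeasurement Ω d A) (θ : Ω → Ω)

theorem integral_quantumProb_word (ω : Ω) (ρ : State d) (n : ℕ) (f : (Fin n → A) → ℝ) :
    ∫ x, f (fun i => x i) ∂(quantumProb V θ ω ρ) =
      ∑ a, outcomeProb (krausProd V θ ω n a) ρ * f a := by
  have hm : Measurable fun (x : ℕ → A) (i : Fin n) => x i := by fun_prop
  rw [← integral_map (φ := fun (x : ℕ → A) (i : Fin n) => x i) (f := f) hm.aemeasurable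
    (Measurable.of_discrete.aestronglyMeasurable),
    integral_fintype .of_finite]
  refine Finset.sum_congr rfl fun a _ => ?_
  rw [smul_eq_mul, Measure.real, Measure.map_apply hm (measurableSet_singleton a)]
  have : (fun (x : ℕ → A) (i : Fin n) => x i) ⁻¹' {a} = {x | ∀ i : Fin n, x i = a i} := by
    ext x
    simp [funext_iff]
  rw [this, quantumProb_cylinder, ENNReal.toReal_ofReal (outcomeProb_nonneg _ _)]

theorem ae_outcomeProb_ne_zero (ω : Ω) (ρ : State d) :
    ∀ᵐ x ∂(quantumProb V θ ω ρ), ∀ n,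
      outcomeProb (krausProd V θ ω n fun i => x i) ρ ≠ 0 := by
  rw [ae_all_iff]
  intro n
  have h : ∀ a : Fin n → A, ∀ᵐ x ∂(quantumProb V θ ω ρ),
      outcomeProb (krausProd V θ ω n a) ρ = 0 → ¬ ∀ i : Fin n, x i = a i := fun a => by
    by_cases ha : outcomeProb (krausProd V θ ω n a) ρ = 0
    · have := quantumProb_cylinder V θ ω ρ n a
      rw [ha, ENNReal.ofReal_zero, measure_eq_zero_iff_ae_notMem] at this
      filter_upwards [this] with x hx _ using hx
    · exact .of_forall fun x h0 => absurd h0 ha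
  filter_upwards [ae_all_iff.2 h] with x hx h0 using hx _ h0 fun _ => rfl

/-- The filtration of the sequences of outcomes whose `n`-th term is generated by the first `n`
outcomes. -/
def wordFiltration (A : Type*) [MeasurableSpace A] :
    Filtration ℕ (inferInstance : MeasurableSpace (ℕ → A)) where
  seq n := MeasurableSpace.comap (fun (x : ℕ → A) (i : Fin n) => x i) inferInstance
  mono' n m hnm := by
    have h : (fun (x : ℕ → A) (i : Fin n) => x i) =
        (fun (y : Fin m → A) (i : Fin n) => y (i.castLE hnm)) ∘
          fun (x : ℕ → A) (i : Fin m) => x i := rfl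
    dsimp only
    rw [h, ← MeasurableSpace.comap_comp]
    exact MeasurableSpace.comap_mono (Measurable.comap_le (by fun_prop))
  le' n := Measurable.comap_le (by fun_prop)

/-- The hypothesis is the supermartingale inequality multiplied by the probability of the word, so
no conditioning on a null word occurs. Summing it over the words in `S` gives the inequality of set
integrals. -/
theorem supermartingale_quantumProb_word (ω : Ω) (ρ : State d) {z : (n : ℕ) → (Fin n → A) → ℝ}
    (hz : ∀ n a, ∑ b, outcomeProb (krausProd V θ ω (n + 1) (Fin.snoc (α := fun _ => A) a b)) ρ *
      z (n + 1) (Fin.snoc (α := fun _ => A) a b) ≤ outcomeProb (krausProd V θ ω n a) ρ * z n a) :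
    Supermartingale (fun n (x : ℕ → A) => z n fun i => x i) (wordFiltration A)
      (quantumProb V θ ω ρ) := by
  classical
  have hm : ∀ n, Measurable fun (x : ℕ → A) (i : Fin n) => x i := fun n => by fun_prop
  refine supermartingale_of_setIntegral_succ_le (fun n => ?_) (fun n => ?_) fun n s hs => ?_
  · exact (Measurable.of_discrete.comp (comap_measurable _)).stronglyMeasurable
  · obtain ⟨C, hC⟩ := (Set.finite_range fun a : Fin n → A => ‖z n a‖).bddAbove
    exact .of_bound (Measurable.of_discrete.comp (hm n)).aestronglyMeasurable C
      (.of_forall fun x => hC ⟨_, rfl⟩)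
  · obtain ⟨S, -, rfl⟩ := hs
    have hS : MeasurableSet ((fun (x : ℕ → A) (i : Fin n) => x i) ⁻¹' S) :=
      hm n MeasurableSet.of_discrete
    have h1 : ∀ x : ℕ → A, ((fun (x : ℕ → A) (i : Fin n) => x i) ⁻¹' S).indicator
        (fun x => z n fun i => x i) x =
        (fun a : Fin n → A => if a ∈ S then z n a else 0) fun i => x i := fun x => by
      simp [Set.indicator_apply]
    have h2 : ∀ x : ℕ → A, ((fun (x : ℕ → A) (i : Fin n) => x i) ⁻¹' S).indicator
        (fun x => z (n + 1) fun i => x i) x =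
        (fun a : Fin (n + 1) → A => if Fin.init (α := fun _ => A) a ∈ S then z (n + 1) a else 0)
          fun i => x i := fun x => by
      simp only [Set.indicator_apply]
      rfl
    rw [← integral_indicator hS, ← integral_indicator hS]
    simp_rw [h1, h2]
    rw [integral_quantumProb_word V θ ω ρ n fun a => if a ∈ S then z n a else 0,
      integral_quantumProb_word V θ ω ρ (n + 1) fun a =>
        if Fin.init (α := fun _ => A) a ∈ S then z (n + 1) a else 0, sum_words_succ]
    refine Finset.sum_le_sum fun a _ => ?_
    simp only [Fin.init_snoc]
    split_ifs with ha
    · exact hz n a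
    · simp

/-- Weighting by the probability of the word cancels the denominator: the supermartingale property
becomes `sum_wedge_le`, and the mean is at most a sum of total areas. -/
theorem ae_tendsto_area_div_outcomeProb (ω : Ω) (ρ : State d) {ι : Type*} [Fintype ι]
    (X : ι → Matrix (Fin d) (Fin 2) ℂ)
    (hX : ∀ i, Tendsto (fun n => wordSum V θ ω n wedge (X i)) atTop (𝓝 0)) :
    ∀ᵐ x ∂(quantumProb V θ ω ρ), Tendsto (fun n =>
      (∑ i, wedge (krausProd V θ ω n (fun j => x j) * X i)) /
        outcomeProb (krausProd V θ ω n fun j => x j) ρ) atTop (𝓝 0) := by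
  let z : (n : ℕ) → (Fin n → A) → ℝ := fun n a =>
    (∑ i, wedge (krausProd V θ ω n a * X i)) / outcomeProb (krausProd V θ ω n a) ρ
  have hnn : ∀ n a, 0 ≤ z n a := fun n a =>
    div_nonneg (Finset.sum_nonneg fun _ _ => wedge_nonneg _) (outcomeProb_nonneg _ _)
  have hle : ∀ n a, outcomeProb (krausProd V θ ω n a) ρ * z n a ≤
      ∑ i, wedge (krausProd V θ ω n a * X i) := fun n a => by
    by_cases h : outcomeProb (krausProd V θ ω n a) ρ = 0
    · rw [h, zero_mul]
      exact Finset.sum_nonneg fun _ _ => wedge_nonneg _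
    · exact (mul_div_cancel₀ _ h).le
  refine Supermartingale.ae_tendsto_zero
    (supermartingale_quantumProb_word V θ ω ρ (z := z) fun n a => ?_) (fun n x => hnn n _) ?_
  -- For a word of probability zero the right side vanishes; so does the left, since all its
  -- extensions have probability zero.
  · by_cases h : outcomeProb (krausProd V θ ω n a) ρ = 0
    · have hs := sum_outcomeProb_mul (V.meas (θ^[n + 1] ω)) (krausProd V θ ω n a) ρ
      rw [h, Finset.sum_eq_zero_iff_of_nonneg fun _ _ => outcomeProb_nonneg _ _] at hs
      rw [h, zero_mul]
      refine (Finset.sum_eq_zero fun b hb => ?_).le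
      rw [krausProd_snoc, hs b hb, zero_mul]
    · refine (Finset.sum_le_sum fun b _ => hle _ _).trans ?_
      rw [Finset.sum_comm, mul_div_cancel₀ _ h]
      refine Finset.sum_le_sum fun i _ => ?_
      simp_rw [krausProd_snoc, Matrix.mul_assoc]
      exact sum_wedge_le (KrausMeasurement.sum_eq_one _) _
  · have hlim : Tendsto (fun n => ∑ i, wordSum V θ ω n wedge (X i)) atTop (𝓝 0) := by
      simpa using tendsto_finsetSum Finset.univ fun i _ => hX i
    refine squeeze_zero (fun n => integral_nonneg fun x => hnn n _) (fun n => ?_) hlim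
    rw [integral_quantumProb_word V θ ω ρ n (z n)]
    refine (Finset.sum_le_sum fun a _ => hle n a).trans_eq ?_
    rw [Finset.sum_comm]
    rfl

end Trajectory

/-! ### Purity and higher moments -/

/-- The eigenvalues are nonnegative with sum 1. Taken as weights, they turn the lower bound into
Jensen's inequality for `t ↦ t ^ (m - 1)`; the upper bound holds because each is at most 1. -/
theorem State.trace_pow_re_bounds {d : ℕ} (ρ : State d) {m : ℕ} (hm : 1 ≤ m) :
    (ρ.mat * ρ.mat).trace.re ^ (m - 1) ≤ (ρ.mat ^ m).trace.re ∧ (ρ.mat ^ m).trace.re ≤ 1 := by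
  have hH := ρ.posSemidef.isHermitian
  have htr : ∀ k, (ρ.mat ^ k).trace.re = ∑ i, hH.eigenvalues i ^ k := fun k => by
    conv_lhs => rw [hH.spectral_theorem, ← map_pow, Matrix.diagonal_pow]
    rw [Unitary.conjStarAlgAut_apply, Matrix.trace_mul_cycle, Unitary.coe_star_mul_self,
      Matrix.one_mul, Matrix.trace_diagonal, Complex.re_sum]
    refine Finset.sum_congr rfl fun i _ => ?_
    simp [← Complex.ofReal_pow]
  have hnn := ρ.posSemidef.eigenvalues_nonneg
  have hsum : ∑ i, hH.eigenvalues i = 1 := by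
    have := htr 1
    simpa [ρ.trace_eq_one] using this.symm
  obtain ⟨m, rfl⟩ := Nat.exists_eq_add_of_le' hm
  rw [← sq, htr, htr, Nat.add_sub_cancel]
  constructor
  · simp_rw [pow_succ' _ m, sq]
    exact Real.pow_arith_mean_le_arith_mean_pow _ _ _ (fun i _ => hnn i) hsum (fun i _ => hnn i) m
  · rw [← hsum]
    refine Finset.sum_le_sum fun i _ => pow_le_of_le_one (hnn i) ?_ (Nat.succ_ne_zero m)
    rw [← hsum]
    exact Finset.single_le_sum (fun j _ => hnn j) (Finset.mem_univ i)

/-- By `sum_wedge_sq` for `W * B`, the defect is a sum of squared areas over the squared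
probability. Bounding it by the square of a sum leaves areas to the first power, the quantity that
is a supermartingale. -/
theorem one_sub_purity_update_le {d : ℕ} (W : Matrix (Fin d) (Fin d) ℂ) {ρ : State d}
    (hW : outcomeProb W ρ ≠ 0) {B : Matrix (Fin d) (Fin d) ℂ} (hB : ρ.mat = B * Bᴴ) :
    1 - ((update W ρ).mat * (update W ρ).mat).trace.re ≤
      ((∑ i : Fin d × Fin d, wedge (W * B.submatrix id ![i.1, i.2])) / outcomeProb W ρ) ^ 2 := by
  have hu : (update W ρ).mat = ((outcomeProb W ρ : ℝ) : ℂ)⁻¹ • ((W * B) * (W * B)ᴴ) := by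
    simp [update, hW, hB, Matrix.conjTranspose_mul, Matrix.mul_assoc]
  have ht : ((W * B) * (W * B)ᴴ).trace.re = outcomeProb W ρ := by
    simp [outcomeProb, hB, Matrix.conjTranspose_mul, Matrix.mul_assoc]
  have hs := sum_wedge_sq (W * B)
  have hp := outcomeProb_nonneg W ρ
  rw [ht, ← Fintype.sum_prod_type'] at hs
  have hsub : ∀ i : Fin d × Fin d,
      (W * B).submatrix id ![i.1, i.2] = W * B.submatrix id ![i.1, i.2] := fun i => by
    rw [Matrix.submatrix_mul W B id id _ Function.bijective_id, Matrix.submatrix_id_id]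
  simp_rw [hsub] at hs
  have hle := Finset.sum_sq_le_sq_sum_of_nonneg (s := Finset.univ)
    (f := fun i : Fin d × Fin d => wedge (W * B.submatrix id ![i.1, i.2]))
    fun i _ => wedge_nonneg _
  have hpur : ((update W ρ).mat * (update W ρ).mat).trace.re =
      ((W * B) * (W * B)ᴴ * ((W * B) * (W * B)ᴴ)).trace.re / outcomeProb W ρ ^ 2 := by
    rw [hu, Matrix.smul_mul, Matrix.mul_smul, smul_smul, Matrix.trace_smul, smul_eq_mul,
      ← Complex.ofReal_inv, ← Complex.ofReal_mul, Complex.re_ofReal_mul]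
    field_simp
  rw [hpur, div_pow, ← div_self (pow_ne_zero 2 hW), ← sub_div]
  gcongr
  exact hs.symm.le.trans hle

/-! ### Purification and dark subspaces -/

section Purification

variable {d : ℕ} {A : Type*} [Fintype A] {Ω : Type*} [MeasurableSpace Ω]
variable [MeasurableSpace A] [MeasurableSingletonClass A]
variable (V : DisorderedMeasurement Ω d A) (θ : Ω → Ω)

theorem mem_purificationEvent_of_tendsto {ω : Ω}
    (h : ∀ X, Tendsto (fun n => wordSum V θ ω n wedge X) atTop (𝓝 0)) :
    ω ∈ purificationEvent V θ := by
  intro ρ m hm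
  obtain ⟨C, hC⟩ := exists_eq_conjTranspose_mul_self ρ.posSemidef
  have hB : ρ.mat = Cᴴ * Cᴴᴴ := by rw [Matrix.conjTranspose_conjTranspose, hC]
  filter_upwards [ae_outcomeProb_ne_zero V θ ω ρ, ae_tendsto_area_div_outcomeProb V θ ω ρ
    (fun i : Fin d × Fin d => Cᴴ.submatrix id ![i.1, i.2]) fun i => h _] with x hx hlim
  let s : ℕ → ℝ := fun n => ((trajState V θ ω ρ n fun i => x i).mat *
    (trajState V θ ω ρ n fun i => x i).mat).trace.re
  have hs1 : ∀ n, s n ≤ 1 := fun n => by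
    have := (State.trace_pow_re_bounds (trajState V θ ω ρ n fun i => x i) one_le_two).2
    rwa [sq] at this
  have hs : Tendsto s atTop (𝓝 1) := by
    have h0 : Tendsto (fun n => 1 - s n) atTop (𝓝 0) :=
      squeeze_zero (fun n => sub_nonneg.2 (hs1 n))
        (fun n => one_sub_purity_update_le _ (hx n) hB) (by simpa using hlim.pow 2)
    simpa using h0.const_sub 1
  refine tendsto_of_tendsto_of_tendsto_of_le_of_le (by simpa using hs.pow (m - 1))
    tendsto_const_nhds (fun n => ?_) fun n => ?_
  · exact (State.trace_pow_re_bounds _ hm).1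
  · exact (State.trace_pow_re_bounds _ hm).2

/-- The uniform state on the range of an isometry `X`. -/
noncomputable def isometryState {X : Matrix (Fin d) (Fin 2) ℂ} (hX : Xᴴ * X = 1) : State d where
  mat := (((2 : ℝ)⁻¹ : ℝ) : ℂ) • (X * Xᴴ)
  posSemidef := (Matrix.posSemidef_self_mul_conjTranspose X).smul
    (Complex.zero_le_real.2 (by norm_num))
  trace_eq_one := by
    rw [Matrix.trace_smul, Matrix.trace_mul_comm, hX]
    simp

theorem purity_isometryState {X : Matrix (Fin d) (Fin 2) ℂ} (hX : Xᴴ * X = 1) :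
    ((isometryState hX).mat * (isometryState hX).mat).trace.re = 1 / 2 := by
  have h : (X * Xᴴ) * (X * Xᴴ) = X * Xᴴ := by
    rw [Matrix.mul_assoc, ← Matrix.mul_assoc Xᴴ, hX, Matrix.one_mul]
  rw [isometryState, Matrix.smul_mul, Matrix.mul_smul, smul_smul, h, Matrix.trace_smul,
    Matrix.trace_mul_comm, hX, ← Complex.ofReal_mul, smul_eq_mul, Complex.re_ofReal_mul]
  simp

theorem purity_update_isometryState {X : Matrix (Fin d) (Fin 2) ℂ} (hX : Xᴴ * X = 1)
    {W : Matrix (Fin d) (Fin d) ℂ} {l : ℝ} (hl : (W * X)ᴴ * (W * X) = (l : ℂ) • 1) :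
    ((update W (isometryState hX)).mat * (update W (isometryState hX)).mat).trace.re = 1 / 2 := by
  have hconj : W * (isometryState hX).mat * Wᴴ = (((2 : ℝ)⁻¹ : ℝ) : ℂ) • ((W * X) * (W * X)ᴴ) := by
    simp [isometryState, Matrix.conjTranspose_mul, Matrix.mul_assoc]
  have hprob : outcomeProb W (isometryState hX) = l := by
    rw [outcomeProb, hconj, Matrix.trace_smul, Matrix.trace_mul_comm, hl, smul_eq_mul,
      Complex.re_ofReal_mul]
    simp
    ring
  -- For an outcome of probability zero `update` returns the initial state, whose purity is also
  -- 1/2, so the value holds for every word and not merely almost surely.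
  by_cases h0 : l = 0
  · have : update W (isometryState hX) = isometryState hX := by simp [update, hprob, h0]
    rw [this, purity_isometryState]
  · have hu : (update W (isometryState hX)).mat =
        ((l⁻¹ * 2⁻¹ : ℝ) : ℂ) • ((W * X) * (W * X)ᴴ) := by
      rw [Complex.ofReal_mul, ← smul_smul, ← hconj]
      simp [update, hprob, h0]
    have hsq : ((W * X) * (W * X)ᴴ) * ((W * X) * (W * X)ᴴ) =
        (l : ℂ) • ((W * X) * (W * X)ᴴ) := by
      rw [Matrix.mul_assoc, ← Matrix.mul_assoc (W * X)ᴴ, hl, Matrix.smul_mul, Matrix.one_mul,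
        Matrix.mul_smul]
    rw [hu, Matrix.smul_mul, Matrix.mul_smul, smul_smul, hsq, smul_smul, Matrix.trace_smul,
      Matrix.trace_mul_comm, hl, ← Complex.ofReal_mul, ← Complex.ofReal_mul, smul_eq_mul,
      Complex.re_ofReal_mul]
    simp
    field_simp

/-- The uniform state on a dark plane has second moment 1/2 along every sequence of outcomes, so it
cannot tend to 1. -/
theorem darkProjections_eq_empty_of_mem_purificationEvent {ω : Ω}
    (h : ω ∈ purificationEvent V θ) : darkProjections V θ ω = ∅ := by
  refine Set.eq_empty_of_forall_notMem fun p hp => ?_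
  obtain ⟨X, hX, hdark⟩ := exists_isometry_of_mem_darkProjections V θ hp
  obtain ⟨x, hx⟩ := (h (isometryState hX) 2 one_le_two).exists
  have hconst : ∀ n, moment V θ ω (isometryState hX) 2 n x = 1 / 2 := fun n => by
    obtain ⟨l, -, hl⟩ := hdark n fun i => x i
    rw [moment, sq]
    exact purity_update_isometryState hX hl
  simp_rw [hconst] at hx
  have := tendsto_nhds_unique hx tendsto_const_nhds
  norm_num at this

end Purification

end QTraj

theorem mainTheorem2 {Ω : Type*} [MeasurableSpace Ω] (P : MeasureTheory.Measure Ω)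
    [MeasureTheory.IsProbabilityMeasure P] (θ : Ω ≃ᵐ Ω) (hθ : Ergodic θ P)
    {A : Type*} [Fintype A] [MeasurableSpace A] [MeasurableSingletonClass A] {d : ℕ}
    (V : QTraj.DisorderedMeasurement Ω d A) :
    MeasurableSet {ω | QTraj.darkProjections V θ ω = ∅} ∧
      (QTraj.AsymptoticallyPurifies V θ P ↔
        0 < P {ω | QTraj.darkProjections V θ ω = ∅}) := by
  refine ⟨QTraj.measurableSet_darkProjections_eq_empty V hθ.measurable, fun h => ?_, fun h => ?_⟩
  · have hae : ∀ᵐ ω ∂P, QTraj.darkProjections V θ ω = ∅ :=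
      h.mono fun ω => QTraj.darkProjections_eq_empty_of_mem_purificationEvent V θ
    have h1 : P {ω | QTraj.darkProjections V θ ω = ∅} = P Set.univ :=
      measure_congr (eventuallyEq_univ.2 hae)
    rw [h1, measure_univ]
    exact one_pos
  · exact (QTraj.ae_tendsto_wordSum_wedge V hθ h.ne').mono fun ω =>
      QTraj.mem_purificationEvent_of_tendsto V θ
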